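/- A \emph{solution} is a pair $(X,r)$, where $X$ is a nonempty set and $r:X\times X\to X\times X$, $r(x,y)=({}^xy,x^y)$, is an involutive map satisfying the braid relation $r^{12}r^{23}r^{12}=r^{23}r^{12}r^{23}$ and such that all maps $\mathcal L_x: y\mapsto {}^xy$ and $\mathcal R_y: x\mapsto x^y$ are bijective; it is \emph{square-free} if $r(x,x)=(x,x)$ for all $x$. Its retraction $\mathrm{Ret}(X,r)$ is the induced solution on the set of classes of the relation $x\sim y\Leftrightarrow \mathcal L_x=\mathcal L_y$; $\mathrm{Ret}^0(X,r)=(X,r)$, $\mathrm{Ret}^{j+1}(X,r)=\mathrm{Ret}(\mathrm{Ret}^{j}(X,r))$, and $\mathrm{mpl}\,X$ is the least $m\ge 0$ such that $\mathrm{Ret}^m(X,r)$ has exactly one element ($\mathrm{mpl}\,X=\infty$ if there is none). $(X,r)$ is a multipermutation solution if $\mathrm{mpl}\,X<\infty$. A left brace is a set $B$ with a group structure $\cdot$ and an abelian group structure $+$ such that $a(b+c)+a=ab+ac$; it is two-sided if moreover $(a+b)c+c=ac+bc$. A left brace carries the solution $r_B(a,b)=({}^ab,a^b)$ with ${}^ab=ab-a$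 and $a^b={}^{({}^ab)^{-1}}a$, and $\mathrm{mpl}\,B$ denotes its multipermutation level. A two-sided brace has an associated (Jacobson) radical ring $B^\star=(B,+,*)$, where $a*b=ab-a-b$. A ring $R$ is nilpotent of class $m$ if $m\geq 1$ is least with $R^m=0$ (where $R^1=R$). Let $G=G(X,r)$ be the group generated by $X$ with the relations $xy={}^xy\,x^y$, $x,y\in X$, and let $\mathcal G=\mathcal G(X,r)\le \mathrm{Sym}(X)$ be its image under $x\mapsto \mathcal L_x$, with their canonical left brace structures: those in which the action ${}^ab = ab-a$ satisfies ${}^g\iota(x)=\iota(g\cdot x)$ for every group element $g$ and every $x\in X$, where $\iota$ is the canonical map of $X$ into the group. Put $\mathcal G_j=\mathcal G(\mathrm{Ret}^j(X,r))$, $j\ge 0$. Let $(X,r)$ be a finite solution. (1) Suppose that the left brace $\mathcal G$ is two-sided and has order $>1$. Then the radical ring $\mathcal G^\star$ is nilpotent of some class $m>1$, $(X,r)$ is a multipermutation solution with $m-1\le \mathrm{mpl}\,X\le m$, and more precisely $$0\le \mathrm{mpl}\,\mathcal G=m-1\le \mathrm{mpl}\,X\le \mathrm{mpl}\,G=m<\infty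 .$$ Moreover, if $(X,r)$ is square-free, then $\mathrm{mpl}\,X=m$. (2) There exists $j\ge 0$ such that $\mathcal G_j$ is a two-sided brace of order $>1$ if and only if either $2\le \mathrm{mpl}\,X<\infty$, or $\mathrm{mpl}\,X=1$ and $\mathcal G\ne\{1\}$. (The second alternative means that $r(x,y)=(f(y),f^{-1}(x))$ for some permutation $f\neq \mathrm{id}_X$ and all $x,y\in X$; it never occurs for square-free $X$.) -/

import Mathlib

universe u

namespace YBE

/-! ### Solutions of the Yang-Baxter equation -/

/-- The map `r × id` on `X × X × X`. -/
def r12 {X : Type u} (r : X × X → X × X) : X × X × X → X × X × X :=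
  fun p => ((r (p.1, p.2.1)).1, (r (p.1, p.2.1)).2, p.2.2)

/-- The map `id × r` on `X × X × X`. -/
def r23 {X : Type u} (r : X × X → X × X) : X × X × X → X × X × X :=
  fun p => (p.1, r p.2)

/-- A solution (non-degenerate symmetric set) on `X`: a non-degenerate involutive set-theoretic
solution `r (x, y) = (ˣy, xʸ)` of the Yang-Baxter equation. -/
@[ext]
structure Solution (X : Type u) where
  /-- the braiding -/
  r : X × X → X × X
  left_nondegenerate : ∀ x, Function.Bijective fun y => (r (x, y)).1
  right_nondegenerate : ∀ y, Function.Bijective fun x => (r (x, y)).2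
  involutive : Function.Involutive r
  braid : r12 r ∘ r23 r ∘ r12 r = r23 r ∘ r12 r ∘ r23 r

namespace Solution

variable {X : Type u} (S : Solution X)

/-- The left action `S.L x y = ˣy`. -/
noncomputable def L (x : X) : Equiv.Perm X := Equiv.ofBijective _ (S.left_nondegenerate x)

/-- The right action `S.R y x = xʸ`. -/
noncomputable def R (y : X) : Equiv.Perm X := Equiv.ofBijective _ (S.right_nondegenerate y)

/-- `(X, r)` is square-free: `r (x, x) = (x, x)` for all `x`. -/
def IsSquareFree : Prop := ∀ x, S.r (x, x) = (x, x)

theorem r_apply (x y : X) : S.r (x, y) = (S.L x y, S.R y x) := rfl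

theorem L_L_R (x y : X) : S.L (S.L x y) (S.R y x) = x :=
  congrArg Prod.fst (S.involutive (x, y))

theorem R_R_L (x y : X) : S.R (S.R y x) (S.L x y) = y :=
  congrArg Prod.snd (S.involutive (x, y))

theorem L_mul_L (x y : X) : S.L x * S.L y = S.L (S.L x y) * S.L (S.R y x) := by
  ext z
  exact (congrArg Prod.fst (congrFun S.braid (x, y, z))).symm

theorem R_mul_R (x y z : X) : S.R z (S.R y x) = S.R (S.R z y) (S.R (S.L y z) x) :=
  congrArg (fun p => p.2.2) (congrFun S.braid (x, y, z))

theorem R_eq (x y : X) : S.R y x = (S.L (S.L x y))⁻¹ x := by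
  rw [Equiv.Perm.eq_inv_iff_eq, L_L_R]

theorem L_eq (x y : X) : S.L x y = (S.R (S.R y x))⁻¹ y := by
  rw [Equiv.Perm.eq_inv_iff_eq, R_R_L]

/-- The map `x ↦ (L x)⁻¹ x`, a bijection. -/
noncomputable def T : Equiv.Perm X where
  toFun x := (S.L x)⁻¹ x
  invFun x := (S.R x)⁻¹ x
  left_inv x := by
    have h : S.R ((S.L x)⁻¹ x) x = (S.L x)⁻¹ x := by
      rw [R_eq]; simp
    rw [Equiv.Perm.inv_eq_iff_eq, h]
  right_inv x := by
    have h : S.L ((S.R x)⁻¹ x) x = (S.R x)⁻¹ x := by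
      rw [L_eq]; simp
    rw [Equiv.Perm.inv_eq_iff_eq, h]

theorem T_apply (x : X) : S.T x = (S.L x)⁻¹ x := rfl

theorem L_T (x : X) : S.L x (S.T x) = x := by simp [T_apply]

theorem T_R (w z : X) : S.T (S.R w z) = (S.L w)⁻¹ (S.T z) := by
  have h : (S.L w)⁻¹ ((S.L z)⁻¹ z) = (S.L z * S.L w)⁻¹ z := by
    rw [mul_inv_rev, Equiv.Perm.mul_apply]
  rw [T_apply, T_apply, h, L_mul_L, mul_inv_rev, Equiv.Perm.mul_apply, ← R_eq]

theorem R_eq_R {x y : X} : S.L x = S.L y ↔ S.R x = S.R y := by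
  constructor
  · intro h
    ext z
    apply S.T.injective
    rw [T_R, T_R, h]
  · intro h
    rw [← inv_inj]
    ext z
    obtain ⟨w, rfl⟩ := S.T.surjective z
    rw [← T_R, ← T_R, h]

/-! ### Retraction -/

/-- The equivalence relation `x ∼ y ↔ L x = L y`. -/
noncomputable def retSetoid : Setoid X := Setoid.ker S.L

theorem L_congr {x x' y y' : X} (hx : S.L x = S.L x') (hy : S.L y = S.L y') :
    S.L (S.L x y) = S.L (S.L x' y') := by
  rw [← hx]
  have h1 := S.L_mul_L x y
  have h2 := S.L_mul_L x y'
  rw [← S.R_eq_R.1 hy, ← hy, h1] at h2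
  exact mul_right_cancel h2

theorem R_congr {x x' y y' : X} (hx : S.L x = S.L x') (hy : S.L y = S.L y') :
    S.L (S.R y x) = S.L (S.R y' x') := by
  have h1 : S.L (S.L x y) * S.L (S.R y x) = S.L (S.L x' y') * S.L (S.R y' x') := by
    rw [← L_mul_L, ← L_mul_L, hx, hy]
  rw [S.L_congr hx hy] at h1
  exact mul_left_cancel h1

/-- The induced map `r ([x], [y]) = ([ˣy], [xʸ])` on the set of classes. -/
noncomputable def retMap (p : Quotient S.retSetoid × Quotient S.retSetoid) :
    Quotient S.retSetoid × Quotient S.retSetoid :=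
  Quotient.liftOn₂ p.1 p.2
    (fun x y => (Quotient.mk _ (S.r (x, y)).1, Quotient.mk _ (S.r (x, y)).2))
    (fun _ _ _ _ hx hy => Prod.ext (Quotient.sound (S.L_congr hx hy))
      (Quotient.sound (S.R_congr hx hy)))

/-- The retraction `Ret (X, r)` of a solution. -/
noncomputable def ret : Solution (Quotient S.retSetoid) where
  r := S.retMap
  left_nondegenerate := by
    intro a
    induction a using Quotient.inductionOn with | _ x
    constructor
    · intro b c
      induction b using Quotient.inductionOn with | _ y
      induction c using Quotient.inductionOn with | _ z
      intro h
      have h : S.L (S.L x y) = S.L (S.L x z) := Quotient.exact h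
      refine Quotient.sound (show S.L y = S.L z from ?_)
      have h1 := S.L_mul_L x y
      rw [R_eq, h, ← R_eq, ← L_mul_L] at h1
      exact mul_left_cancel h1
    · intro b
      induction b using Quotient.inductionOn with | _ y
      obtain ⟨z, hz⟩ := (S.L x).surjective y
      exact ⟨Quotient.mk _ z, congrArg _ hz⟩
  right_nondegenerate := by
    intro a
    induction a using Quotient.inductionOn with | _ x
    constructor
    · intro b c
      induction b using Quotient.inductionOn with | _ y
      induction c using Quotient.inductionOn with | _ z
      intro h
      have h : S.L (S.R x y) = S.L (S.R x z) := Quotient.exact h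
      rw [R_eq_R] at h
      refine Quotient.sound (show S.L y = S.L z from ?_)
      rw [R_eq_R]
      ext w
      apply (S.R x).injective
      rw [R_mul_R, L_eq, h, ← L_eq, ← R_mul_R]
    · intro b
      induction b using Quotient.inductionOn with | _ y
      obtain ⟨z, hz⟩ := (S.R x).surjective y
      exact ⟨Quotient.mk _ z, congrArg _ hz⟩
  involutive := by
    rintro ⟨a, b⟩
    induction a using Quotient.inductionOn with | _ x
    induction b using Quotient.inductionOn with | _ y
    exact Prod.ext (congrArg (Quotient.mk _) (S.L_L_R x y))
      (congrArg (Quotient.mk _) (S.R_R_L x y))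
  braid := by
    funext p
    obtain ⟨a, b, c⟩ := p
    induction a using Quotient.inductionOn with | _ x
    induction b using Quotient.inductionOn with | _ y
    induction c using Quotient.inductionOn with | _ z
    have h := congrFun S.braid (x, y, z)
    exact Prod.ext (congrArg (fun p : X × X × X => Quotient.mk S.retSetoid p.1) h)
      (Prod.ext (congrArg (fun p : X × X × X => Quotient.mk S.retSetoid p.2.1) h)
        (congrArg (fun p : X × X × X => Quotient.mk S.retSetoid p.2.2) h))

end Solution

/-- A solution bundled with its underlying set. -/
structure BundledSolution where
  /-- the underlying set -/
  carrier : Type u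
  /-- the solution -/
  sol : Solution carrier

namespace Solution

variable {X : Type u} (S : Solution X)

/-- The higher retractions `Ret^m (X, r)`: `Ret^0 (X, r) = (X, r)` and
`Ret^(m+1) (X, r) = Ret (Ret^m (X, r))`. -/
noncomputable def retIter : ℕ → BundledSolution.{u}
  | 0 => ⟨X, S⟩
  | m + 1 => ⟨_, (retIter m).sol.ret⟩

/-- The multipermutation level `mpl (X, r)`: the least `m` such that `Ret^m (X, r)` is a one element
solution, and `⊤` if there is none. -/
noncomputable def mpl : ℕ∞ :=
  sInf {n : ℕ∞ | ∃ m : ℕ, n = m ∧ Nat.card (S.retIter m).carrier = 1}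

end Solution

/-! ### Braces -/

/-- A left brace: a set with a group structure `*` and an abelian group structure `+` such that
`a (b + c) + a = a b + a c`. -/
class LeftBrace (B : Type u) extends Group B, AddCommGroup B where
  left_brace : ∀ a b c : B, a * (b + c) + a = a * b + a * c

/-- A left brace is two-sided if it is also a right brace. -/
def IsTwoSided (B : Type u) [LeftBrace B] : Prop :=
  ∀ a b c : B, (a + b) * c + c = a * c + b * c

namespace LeftBrace

variable {B : Type u} [LeftBrace B]

/-- The left action `ᵃb = a b - a` of a left brace on itself. -/
def lam (a b : B) : B := a * b - a

/-- The right action `aᵇ = ^((ᵃb)⁻¹) a` of a left brace on itself. -/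
def rho (b a : B) : B := lam (lam a b)⁻¹ a

theorem add_lam (a b : B) : a + lam a b = a * b := by simp [lam]

theorem mul_zero' (a : B) : a * 0 = a := by
  have h := left_brace a 0 0
  rw [add_zero] at h
  exact (add_left_cancel h).symm

theorem one_eq_zero : (1 : B) = 0 := by
  rw [← mul_zero' (1 : B), one_mul]

theorem lam_add (a b c : B) : lam a (b + c) = lam a b + lam a c := by
  have h := left_brace a b c
  simp only [lam]
  rw [eq_sub_of_add_eq h]
  abel

theorem lam_mul (a b c : B) : lam (a * b) c = lam a (lam b c) := by
  have h : lam a (b * c) = lam a b + lam a (lam b c) := by rw [← lam_add, add_lam]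
  have h2 : lam a (lam b c) = lam a (b * c) - lam a b := by rw [h]; abel
  rw [h2]
  simp only [lam, mul_assoc]
  abel

theorem lam_one (b : B) : lam 1 b = b := by simp [lam, one_eq_zero]

theorem lam_inv_lam (a b : B) : lam a⁻¹ (lam a b) = b := by rw [← lam_mul]; simp [lam_one]

theorem lam_lam_inv (a b : B) : lam a (lam a⁻¹ b) = b := by rw [← lam_mul]; simp [lam_one]

theorem lam_mul_rho (a b : B) : lam a b * rho b a = a * b := by
  rw [← add_lam, rho, lam_lam_inv, add_comm, add_lam]

theorem rho_eq (a b : B) : rho b a = (lam a b)⁻¹ * (a * b) := by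
  rw [eq_inv_mul_iff_mul_eq, lam_mul_rho]

theorem lam_mul_right (a b c : B) : lam a (b * c) = lam a b * lam (rho b a) c := by
  rw [← add_lam, lam_add, ← add_lam, ← lam_mul, ← lam_mul, lam_mul_rho]

theorem rho_mul (a b c : B) : rho (b * c) a = rho c (rho b a) := by
  simp only [rho_eq]
  rw [lam_mul_right, rho_eq]
  group

theorem rho_one (a : B) : rho 1 a = a := by
  rw [rho_eq, lam, mul_one, sub_self, ← one_eq_zero, inv_one, one_mul]

/-- The solution `r (a, b) = (ᵃb, aᵇ)` associated with a left brace. -/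
def toSolution (B : Type u) [LeftBrace B] : Solution B where
  r p := (lam p.1 p.2, rho p.2 p.1)
  left_nondegenerate a :=
    Function.bijective_iff_has_inverse.2 ⟨lam a⁻¹, lam_inv_lam a, lam_lam_inv a⟩
  right_nondegenerate b :=
    Function.bijective_iff_has_inverse.2 ⟨rho b⁻¹,
      fun a => by simp [← rho_mul, rho_one], fun a => by simp [← rho_mul, rho_one]⟩
  involutive := by
    rintro ⟨a, b⟩
    have h : lam (lam a b) (rho b a) = a := by rw [rho, lam_lam_inv]
    refine Prod.ext h ?_
    change rho (rho b a) (lam a b) = b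
    rw [rho_eq, h, lam_mul_rho]
    simp
  braid := by
    funext p
    obtain ⟨a, b, c⟩ := p
    have h1 : lam (lam a b) (lam (rho b a) c) = lam a (lam b c) := by
      rw [← lam_mul, lam_mul_rho, lam_mul]
    have h3 : rho c (rho b a) = rho (rho c b) (rho (lam b c) a) := by
      rw [← rho_mul, ← rho_mul, lam_mul_rho]
    have h2 : rho (lam (rho b a) c) (lam a b) = lam (rho (lam b c) a) (rho c b) := by
      have e1 : lam (lam a b) (lam (rho b a) c) * rho (lam (rho b a) c) (lam a b) *
          rho c (rho b a) = a * b * c := by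
        rw [lam_mul_rho, mul_assoc, lam_mul_rho, ← mul_assoc, lam_mul_rho]
      have e2 : lam a (lam b c) * lam (rho (lam b c) a) (rho c b) *
          rho (rho c b) (rho (lam b c) a) = a * b * c := by
        rw [mul_assoc, lam_mul_rho, ← mul_assoc, lam_mul_rho, mul_assoc, lam_mul_rho, mul_assoc]
      rw [h1, h3, ← e2] at e1
      exact mul_left_cancel (mul_right_cancel e1)
    exact Prod.ext h1 (Prod.ext h2 h3)

end LeftBrace

/-- The radical ring of a two-sided brace `(B, +, *)`: the abelian group `(B, +)` with the product
`a b - a - b`. Its circle operation `a + b + a ⋆ b` is the multiplication of the brace. -/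
def RadicalRing {B : Type u} [LeftBrace B] (_ : IsTwoSided B) : Type u := B

instance {B : Type u} [LeftBrace B] (h : IsTwoSided B) : NonUnitalRing (RadicalRing h) where
  __ := (inferInstance : AddCommGroup B)
  mul (a b : B) := (a * b - a - b : B)
  left_distrib (a b c : B) := by
    change a * (b + c) - a - (b + c) = (a * b - a - b) + (a * c - a - c)
    rw [eq_sub_of_add_eq (LeftBrace.left_brace a b c)]
    abel
  right_distrib (a b c : B) := by
    change (a + b) * c - (a + b) - c = (a * c - a - c) + (b * c - b - c)
    rw [eq_sub_of_add_eq (h a b c)]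
    abel
  zero_mul (a : B) := by
    change (0 : B) * a - 0 - a = 0
    have h0 : (0 : B) * a = a := by rw [← LeftBrace.one_eq_zero, one_mul]
    simp [h0]
  mul_zero (a : B) := by
    change a * (0 : B) - a - 0 = 0
    simp [LeftBrace.mul_zero']
  mul_assoc (a b c : B) := by
    change (a * b - a - b) * c - (a * b - a - b) - c = a * (b * c - b - c) - a - (b * c - b - c)
    have hs : ∀ x y z : B, (x - y) * z = x * z - y * z + z := fun x y z => by
      have := h (x - y) y z
      rw [sub_add_cancel] at this
      rw [eq_sub_of_add_eq this.symm]; abel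
    have hs' : ∀ x y z : B, x * (y - z) = x * y - x * z + x := fun x y z => by
      have := LeftBrace.left_brace x (y - z) z
      rw [sub_add_cancel] at this
      rw [eq_sub_of_add_eq this.symm]; abel
    simp only [hs, hs', mul_assoc]
    abel

/-- The powers `R^1 = R`, `R^(k+1) = R^k R` of a non-unital ring (with `R^0 = R` by convention):
`R^k` is the additive subgroup generated by the products of `k` elements. -/
def ringPower (R : Type u) [NonUnitalRing R] : ℕ → AddSubgroup R
  | 0 => ⊤
  | 1 => ⊤
  | k + 2 => AddSubgroup.closure {c | ∃ a ∈ ringPower R (k + 1), ∃ b : R, c = a * b}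

/-- `R` is nilpotent of class `m`: `m ≥ 1` is the least exponent with `R^m = 0`. -/
def IsNilpotentOfClass (R : Type u) [NonUnitalRing R] (m : ℕ) : Prop :=
  1 ≤ m ∧ ringPower R m = ⊥ ∧ ∀ k, 1 ≤ k → k < m → ringPower R k ≠ ⊥

/-! ### The canonical brace structure on a group generated by a solution -/

/-- A group `K` with a map `ι : X → K` whose image generates `K`, such that the relations
`x y = ˣy xʸ` hold in `K` and the left action of `X` on itself extends to `K`. -/
structure YBData {X : Type u} (S : Solution X) (K : Type u) [Group K] where
  /-- the canonical map -/
  ι : X → K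
  /-- the left action of `K` on `X` -/
  ρ : K →* Equiv.Perm X
  ρ_ι : ∀ x, ρ (ι x) = S.L x
  rel : ∀ x y, ι x * ι y = ι (S.L x y) * ι (S.R y x)
  gen : Subgroup.closure (Set.range ι) = ⊤

namespace YBData

variable {X : Type u} {S : Solution X} {K : Type u} [Group K] (D : YBData S K)

/-- The permutation `g ↦ g · ι (^(g⁻¹) x)` of `K`; it is the translation by `ι x` in the additive
group of the brace. -/
noncomputable def shift (x : X) : Equiv.Perm K where
  toFun g := g * D.ι (D.ρ g⁻¹ x)
  invFun g := g * (D.ι (S.T.symm (D.ρ g⁻¹ x)))⁻¹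
  left_inv g := by
    have h : S.T.symm (D.ρ (g * D.ι (D.ρ g⁻¹ x))⁻¹ x) = D.ρ g⁻¹ x := by
      rw [Equiv.symm_apply_eq, S.T_apply, mul_inv_rev, map_mul, map_inv D.ρ (D.ι _), D.ρ_ι,
        Equiv.Perm.mul_apply]
    simp only [h]
    simp
  right_inv g := by
    have h : ∀ w, S.T w = D.ρ g⁻¹ x → D.ρ (g * (D.ι w)⁻¹)⁻¹ x = w := by
      intro w hw
      rw [mul_inv_rev, inv_inv, map_mul, D.ρ_ι, Equiv.Perm.mul_apply, ← hw, S.L_T]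
    simp only [h _ (S.T.apply_symm_apply _)]
    simp

theorem shift_apply (x : X) (g : K) : D.shift x g = g * D.ι (D.ρ g⁻¹ x) := rfl

theorem shift_comm (x y : X) : D.shift x * D.shift y = D.shift y * D.shift x := by
  ext g
  simp only [Equiv.Perm.mul_apply, shift_apply, mul_assoc, mul_inv_rev, map_mul]
  rw [map_inv D.ρ (D.ι _), map_inv D.ρ (D.ι _), D.ρ_ι, D.ρ_ι, D.rel, S.R_eq]
  simp

/-- The abelian group of permutations of `K` generated by the permutations `shift x`. -/
def translations : Subgroup (Equiv.Perm K) := Subgroup.closure (Set.range D.shift)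

theorem translations_comm {a b : Equiv.Perm K} (ha : a ∈ D.translations)
    (hb : b ∈ D.translations) : a * b = b * a := by
  have h : IsMulCommutative D.translations := Subgroup.isMulCommutative_closure (by
    rintro _ ⟨x, rfl⟩ _ ⟨y, rfl⟩
    exact D.shift_comm x y)
  exact congrArg Subtype.val (h.is_comm.comm (⟨a, ha⟩ : D.translations) ⟨b, hb⟩)

instance : CommGroup D.translations where
  mul_comm a b := Subtype.ext (D.translations_comm a.2 b.2)

theorem exists_translation (g : K) : ∃ a : D.translations, a.1 1 = g := by
  have hg : g ∈ Subgroup.closure (Set.range D.ι) := D.gen ▸ Subgroup.mem_top g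
  have hx : ∀ x, D.shift x ∈ D.translations := fun x => Subgroup.subset_closure ⟨x, rfl⟩
  induction hg using Subgroup.closure_induction_right with
  | one => exact ⟨1, rfl⟩
  | mul_right g y _ hy ih =>
    obtain ⟨x, rfl⟩ := hy
    obtain ⟨a, rfl⟩ := ih
    refine ⟨⟨_, hx (D.ρ (a.1 1) x)⟩ * a, ?_⟩
    change D.shift _ (a.1 1) = _
    simp [shift_apply]
  | mul_inv_cancel g y _ hy ih =>
    obtain ⟨x, rfl⟩ := hy
    obtain ⟨a, rfl⟩ := ih
    refine ⟨⟨_, hx (D.ρ (a.1 1 * (D.ι x)⁻¹) x)⟩⁻¹ * a, ?_⟩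
    change (D.shift _)⁻¹ (a.1 1) = _
    rw [Equiv.Perm.inv_eq_iff_eq, shift_apply, ← Equiv.Perm.mul_apply, ← map_mul]
    simp

/-- The group of translations acts simply transitively on `K`. -/
noncomputable def translationEquiv : K ≃ D.translations :=
  (Equiv.ofBijective (fun a : D.translations => a.1 1) ⟨by
    intro a b hab
    ext g
    obtain ⟨c, rfl⟩ := D.exists_translation g
    rw [← Equiv.Perm.mul_apply, ← Equiv.Perm.mul_apply, D.translations_comm a.2 c.2,
      D.translations_comm b.2 c.2, Equiv.Perm.mul_apply, Equiv.Perm.mul_apply]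
    exact congrArg _ hab, D.exists_translation⟩).symm

theorem translationEquiv_symm_apply (a : D.translations) : D.translationEquiv.symm a = a.1 1 := rfl

theorem translationEquiv_apply_one (g : K) : (D.translationEquiv g).1 1 = g :=
  D.translationEquiv.symm_apply_apply g

/-- The addition of the brace: the abelian group structure transported from the group of
translations along `a ↦ a 1`. -/
noncomputable abbrev addCommGroup : AddCommGroup K :=
  (D.translationEquiv.trans Additive.ofMul).addCommGroup

theorem add_def (a b : K) :
    letI := D.addCommGroup
    a + b = (D.translationEquiv a).1 b :=
  congrArg (D.translationEquiv a).1 (D.translationEquiv_apply_one b)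

theorem translationEquiv_eq {g : K} {a : Equiv.Perm K} (ha : a ∈ D.translations) (h : a 1 = g) :
    (D.translationEquiv g).1 = a := by
  have : D.translationEquiv g = ⟨a, ha⟩ := by
    rw [← Equiv.eq_symm_apply]; exact h.symm
  rw [this]

theorem conj_mem (g : K) {a : Equiv.Perm K} (ha : a ∈ D.translations) :
    Equiv.mulLeft g * a * (Equiv.mulLeft g)⁻¹ ∈ D.translations := by
  have hg : ∀ x, Equiv.mulLeft g * D.shift x * (Equiv.mulLeft g)⁻¹ = D.shift (D.ρ g x) := by
    intro x
    ext k
    simp [shift_apply, mul_assoc]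
  have h : D.translations ≤ D.translations.comap (MulAut.conj (Equiv.mulLeft g)).toMonoidHom := by
    refine (Subgroup.closure_le _).2 ?_
    rintro _ ⟨x, rfl⟩
    refine Subgroup.subset_closure ⟨D.ρ g x, ?_⟩
    exact (hg x).symm
  exact h ha

/-- The canonical left brace structure on `K`. -/
noncomputable abbrev leftBrace : LeftBrace K where
  __ := ‹Group K›
  __ := D.addCommGroup
  left_brace a b c := by
    let := D.addCommGroup
    set β := D.translationEquiv b with hβ
    set α := D.translationEquiv a with hα
    have hb : (D.translationEquiv (a * b)).1 =
        (Equiv.mulLeft a * β.1 * (Equiv.mulLeft a)⁻¹) * α.1 := by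
      refine D.translationEquiv_eq (mul_mem (D.conj_mem a β.2) α.2) ?_
      simp [hα, hβ, translationEquiv_apply_one]
    have key : a * (b + c) + a = a * b + a * c := by
      rw [add_comm, add_def, add_def, add_def, hb, D.translations_comm (D.conj_mem a β.2) α.2]
      simp [hα, hβ]
    exact key

/-- The left action of the brace `K` on itself extends the left action of `K` on `X`. -/
theorem lam_ι (g : K) (x : X) :
    letI := D.leftBrace
    LeftBrace.lam g (D.ι x) = D.ι (D.ρ g x) := by
  let := D.leftBrace
  have hx : D.shift (D.ρ g x) ∈ D.translations := Subgroup.subset_closure ⟨_, rfl⟩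
  have h : D.ι (D.ρ g x) + g = g * D.ι x := by
    refine (D.add_def _ _).trans ?_
    rw [D.translationEquiv_eq hx (by simp [shift_apply]), shift_apply,
      ← Equiv.Perm.mul_apply, ← map_mul]
    simp
  rw [LeftBrace.lam, ← h, add_sub_cancel_right]

/-- The braiding of the brace `K` extends the braiding of `X` along the canonical map. -/
theorem toSolution_ι (x y : X) :
    letI := D.leftBrace
    (LeftBrace.toSolution K).r (D.ι x, D.ι y) = (D.ι (S.r (x, y)).1, D.ι (S.r (x, y)).2) := by
  let := D.leftBrace
  have h : LeftBrace.lam (D.ι x) (D.ι y) = D.ι (S.L x y) := by rw [lam_ι, D.ρ_ι]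
  refine Prod.ext h ?_
  change LeftBrace.rho (D.ι y) (D.ι x) = D.ι (S.R y x)
  rw [LeftBrace.rho_eq, h, inv_mul_eq_iff_eq_mul]
  exact D.rel x y

end YBData

namespace Solution

variable {X : Type u} (S : Solution X)

/-- The defining relations `x y = ˣy xʸ` of the group `G(X, r)`. -/
def relations : Set (FreeGroup X) :=
  {w | ∃ x y : X, w = FreeGroup.of x * FreeGroup.of y *
    (FreeGroup.of (S.r (x, y)).1 * FreeGroup.of (S.r (x, y)).2)⁻¹}

/-- The Yang-Baxter group (structure group) `G(X, r)`, generated by `X` with the relations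
`x y = ˣy xʸ`. -/
def YBGroup : Type u := PresentedGroup S.relations

instance instGroupYBGroup : Group S.YBGroup := inferInstanceAs (Group (PresentedGroup S.relations))

/-- The canonical map `X → G(X, r)`. -/
def toYBGroup (x : X) : S.YBGroup := PresentedGroup.of (rels := S.relations) x

/-- The canonical left action of `G(X, r)` on `X`, extending `x ↦ L x`. -/
noncomputable def leftAction : S.YBGroup →* Equiv.Perm X :=
  PresentedGroup.toGroup (f := S.L) (rels := S.relations) (by
    rintro _ ⟨x, y, rfl⟩
    simp only [map_mul, map_inv, FreeGroup.lift_apply_of]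
    rw [mul_inv_eq_one]
    exact S.L_mul_L x y)

theorem leftAction_of (x : X) : S.leftAction (S.toYBGroup x) = S.L x :=
  PresentedGroup.toGroup.of _

theorem toYBGroup_rel (x y : X) : S.toYBGroup x * S.toYBGroup y =
    S.toYBGroup (S.L x y) * S.toYBGroup (S.R y x) := by
  rw [← mul_inv_eq_one]
  exact PresentedGroup.one_of_mem (rels := S.relations) ⟨x, y, rfl⟩

theorem closure_range_toYBGroup : Subgroup.closure (Set.range S.toYBGroup) = ⊤ :=
  PresentedGroup.closure_range_of S.relations

/-- `G(X, r)` with its canonical action on `X`. -/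
noncomputable def ybGroupData : YBData S S.YBGroup where
  ι := S.toYBGroup
  ρ := S.leftAction
  ρ_ι := S.leftAction_of
  rel := S.toYBGroup_rel
  gen := S.closure_range_toYBGroup

/-- The left brace `(G(X, r), +, ·)`. -/
noncomputable instance : LeftBrace S.YBGroup := S.ybGroupData.leftBrace

/-- The permutation group `𝒢(X, r)`, the image of `G(X, r)` in `Sym X`, that is the subgroup of
`Sym X` generated by the permutations `L x`. -/
def PermGroup : Type u := S.leftAction.range

noncomputable instance instGroupPermGroup : Group S.PermGroup :=
  inferInstanceAs (Group S.leftAction.range)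

/-- The canonical epimorphism `G(X, r) → 𝒢(X, r)`. -/
noncomputable def toPermGroup : S.YBGroup →* S.PermGroup := S.leftAction.rangeRestrict

/-- `𝒢(X, r)` with its tautological action on `X`. -/
noncomputable def permGroupData : YBData S S.PermGroup where
  ι x := S.toPermGroup (S.toYBGroup x)
  ρ := S.leftAction.range.subtype
  ρ_ι := S.leftAction_of
  rel x y := by rw [← map_mul, toYBGroup_rel, map_mul]
  gen := by
    have h := congrArg (Subgroup.map S.toPermGroup) S.closure_range_toYBGroup
    rw [MonoidHom.map_closure, ← Set.range_comp] at h
    exact h.trans (Subgroup.map_top_of_surjective _ S.leftAction.rangeRestrict_surjective)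

/-- The left brace `(𝒢(X, r), +, ·)`. -/
noncomputable instance : LeftBrace S.PermGroup := S.permGroupData.leftBrace

/-- The symmetric group `(G(X, r), r_G)`, as a solution. -/
noncomputable def ybSolution : Solution S.YBGroup := LeftBrace.toSolution S.YBGroup

/-- The symmetric group `(𝒢(X, r), r_𝒢)`, as a solution. -/
noncomputable def permSolution : Solution S.PermGroup := LeftBrace.toSolution S.PermGroup

/-- The derived permutation group `𝒢_j = 𝒢(Ret^j (X, r))`, a left brace. -/
abbrev DerivedPermGroup (j : ℕ) : Type u := (S.retIter j).sol.PermGroup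

end Solution

end YBE

/-! Two points agree in Ret^(k+1) exactly when ˣz and ʸz agree in Ret^k for all z. So mpl X ≤ k
means that a recursively defined relation on X itself (`retRel`) is total, and iterated quotients
disappear from the argument. In a two-sided brace, ᵃz - ᵇz = (a - b) * z. Hence a and b agree in
Ret^k iff (a - b)R^k = 0 in the radical ring R (`retRel_toSolution_iff`), and nilpotency class m
gives mpl = m - 1. A finite radical ring is nilpotent by a Nakayama-type argument
(`exists_proper_right_ideal`).

For a finite solution with 𝒢 two-sided, the upper bound comes from G: 𝒢 is the retraction of G, so
mpl G = mpl 𝒢 + 1 = m (`mpl_permSolution_le_iff`), and X embeds in G (`toYBGroup_injective`). The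
lower bound comes from the map X → 𝒢, whose image generates 𝒢 additively: points that agree in
Ret^(k+1) have images differing by an element that kills R^k, and g * ι x = ι(gx) - ι x turns this
into mpl 𝒢 ≤ mpl X. For square-free X the identity x * x = 0 saves one more level.

For part (2), if mpl X = n is finite, 𝒢_(n-1) is a trivial brace, and if it has order 1 then 𝒢_(n-2)
is a trivial brace; trivial braces are two-sided. Conversely, part (1) applied to Ret^j X bounds mpl
X. -/

namespace YBE

/-! ### The congruences defining the higher retractions -/

namespace Solution

variable {X Y : Type u} (S : Solution X) {T : Solution Y}

/-- The relation whose classes are the elements of `Ret^k (X, r)`. -/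
def retRel : ℕ → X → X → Prop
  | 0 => Eq
  | k + 1 => fun x y => ∀ z, retRel k (S.L x z) (S.L y z)

theorem retRel_one {x y : X} : S.retRel 1 x y ↔ S.L x = S.L y :=
  ⟨fun h => Equiv.ext h, fun h z => DFunLike.congr_fun h z⟩

theorem retRel_total_succ {k : ℕ} (h : ∀ x y, S.retRel k x y) : ∀ x y, S.retRel (k + 1) x y :=
  fun _ _ _ => h _ _

theorem retRel_total_mono {k l : ℕ} (hkl : k ≤ l) (h : ∀ x y, S.retRel k x y) :
    ∀ x y, S.retRel l x y := by
  induction hkl with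
  | refl => exact h
  | step _ ih => exact S.retRel_total_succ ih

/-- The relation on Y tests against all of Y, hence in particular against the points f z. -/
theorem retRel_of_injective {f : X → Y} (hf : Function.Injective f)
    (hL : ∀ x y, f (S.L x y) = T.L (f x) (f y)) {k : ℕ} {x y : X}
    (h : T.retRel k (f x) (f y)) : S.retRel k x y := by
  induction k generalizing x y with
  | zero => exact hf h
  | succ k ih =>
    intro z
    apply ih
    rw [hL, hL]
    exact h (f z)

/-- Surjectivity lets the test points of Y be lifted to X. Besides X → Ret^j X, this is applied with
j = 1 to G → 𝒢. -/
theorem retRel_add {p : X → Y} (hp : Function.Surjective p)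
    (hL : ∀ x y, p (S.L x y) = T.L (p x) (p y)) {j : ℕ}
    (hj : ∀ x y, p x = p y ↔ S.retRel j x y) {k : ℕ} {x y : X} :
    T.retRel k (p x) (p y) ↔ S.retRel (j + k) x y := by
  induction k generalizing x y with
  | zero => exact hj x y
  | succ k ih => simp only [retRel, hp.forall, ← hL, ih, Nat.add_eq]

theorem exists_retIter_projection (k : ℕ) : ∃ p : X → (S.retIter k).carrier,
    Function.Surjective p ∧ (∀ x y, p (S.L x y) = (S.retIter k).sol.L (p x) (p y)) ∧
      ∀ x y, p x = p y ↔ S.retRel k x y := by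
  induction k with
  | zero => exact ⟨id, Function.surjective_id, fun _ _ => rfl, fun _ _ => Iff.rfl⟩
  | succ k ih =>
    obtain ⟨p, hp, hL, hk⟩ := ih
    refine ⟨fun x => Quotient.mk (S.retIter k).sol.retSetoid (p x),
      Quotient.mk_surjective.comp hp,
      fun x y => congrArg (Quotient.mk (S.retIter k).sol.retSetoid) (hL x y),
      fun x y => Quotient.eq.trans ?_⟩
    change (S.retIter k).sol.L (p x) = (S.retIter k).sol.L (p y) ↔ _
    rw [← retRel_one]
    exact S.retRel_add hp hL hk

theorem card_retIter_eq_one_iff [Nonempty X] (k : ℕ) :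
    Nat.card (S.retIter k).carrier = 1 ↔ ∀ x y, S.retRel k x y := by
  obtain ⟨p, hp, -, hk⟩ := S.exists_retIter_projection k
  have : Nonempty (S.retIter k).carrier := (inferInstance : Nonempty X).map p
  rw [Nat.card_eq_one_iff_unique, and_iff_left this, subsingleton_iff, hp.forall]
  simp only [hp.forall, hk]

theorem mpl_le_iff [Nonempty X] {k : ℕ} : S.mpl ≤ k ↔ ∀ x y, S.retRel k x y := by
  constructor
  · intro h
    -- The infimum of the empty set would be ⊤, which is not ≤ k; so the infimum is attained.
    have hne : {n : ℕ∞ | ∃ m : ℕ, n = m ∧ Nat.card (S.retIter m).carrier = 1}.Nonempty := by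
      rw [Set.nonempty_iff_ne_empty]
      intro he
      rw [mpl, he, sInf_empty] at h
      exact absurd h (by simp)
    obtain ⟨m, hm, hc⟩ := csInf_mem hne
    rw [mpl, hm, Nat.cast_le] at h
    exact S.retRel_total_mono h ((S.card_retIter_eq_one_iff m).1 hc)
  · intro h
    exact sInf_le ⟨k, rfl, (S.card_retIter_eq_one_iff k).2 h⟩

theorem mpl_le_add_iff [Nonempty X] [Nonempty Y] {p : X → Y} (hp : Function.Surjective p)
    (hL : ∀ x y, p (S.L x y) = T.L (p x) (p y)) {j : ℕ}
    (hj : ∀ x y, p x = p y ↔ S.retRel j x y) {k : ℕ} :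
    T.mpl ≤ k ↔ S.mpl ≤ (j + k : ℕ) := by
  rw [mpl_le_iff, mpl_le_iff, hp.forall]
  simp only [hp.forall, S.retRel_add hp hL hj]

instance [Nonempty X] (j : ℕ) : Nonempty (S.retIter j).carrier :=
  (inferInstance : Nonempty X).map (S.exists_retIter_projection j).choose

instance [Finite X] (j : ℕ) : Finite (S.retIter j).carrier :=
  Finite.of_surjective _ (S.exists_retIter_projection j).choose_spec.1

theorem mpl_retIter_le_iff [Nonempty X] {j k : ℕ} :
    (S.retIter j).sol.mpl ≤ k ↔ S.mpl ≤ (j + k : ℕ) := by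
  obtain ⟨p, hp, hL, hj⟩ := S.exists_retIter_projection j
  exact S.mpl_le_add_iff hp hL hj

end Solution

/-! ### Nilpotency of radical rings -/

section Ring

variable {R : Type u} [NonUnitalRing R]

/-- The elements `a` with `a R^k = 0`, where `a R^0 = 0` means `a = 0`. -/
def leftAnnihilator (R : Type u) [NonUnitalRing R] : ℕ → AddSubgroup R
  | 0 => ⊥
  | k + 1 =>
    { carrier := {a | ∀ b, a * b ∈ leftAnnihilator R k}
      zero_mem' := fun b => by simp
      add_mem' := fun ha hb c => by rw [add_mul]; exact add_mem (ha c) (hb c)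
      neg_mem' := fun ha c => by rw [neg_mul]; exact neg_mem (ha c) }

theorem mem_leftAnnihilator_zero {a : R} : a ∈ leftAnnihilator R 0 ↔ a = 0 := AddSubgroup.mem_bot

theorem mem_leftAnnihilator_succ {k : ℕ} {a : R} :
    a ∈ leftAnnihilator R (k + 1) ↔ ∀ b, a * b ∈ leftAnnihilator R k := Iff.rfl

theorem mem_leftAnnihilator_succ_of_closure {s : Set R} (hs : AddSubgroup.closure s = ⊤) {k : ℕ}
    {a : R} (h : ∀ b ∈ s, a * b ∈ leftAnnihilator R k) : a ∈ leftAnnihilator R (k + 1) := by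
  intro b
  have hle : AddSubgroup.closure s ≤ (leftAnnihilator R k).comap (AddMonoidHom.mulLeft a) :=
    (AddSubgroup.closure_le _).2 h
  exact hle (hs ▸ AddSubgroup.mem_top b)

theorem mul_mem_ringPower {k : ℕ} {a : R} (ha : a ∈ ringPower R (k + 1)) (b : R) :
    a * b ∈ ringPower R (k + 2) :=
  AddSubgroup.subset_closure ⟨a, ha, b, rfl⟩

theorem ringPower_succ_le (k : ℕ) : ringPower R (k + 2) ≤ ringPower R (k + 1) := by
  induction k with
  | zero => exact le_top
  | succ k ih =>
    refine (AddSubgroup.closure_le _).2 ?_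
    rintro _ ⟨a, ha, b, rfl⟩
    exact mul_mem_ringPower (ih ha) b

/-- Both sides say R^(j+1) R^k = 0; the induction moves one factor at a time. Writing j + 1 avoids
the conventional value R^0 = R. -/
theorem ringPower_le_leftAnnihilator_iff {j k : ℕ} :
    ringPower R (j + 1) ≤ leftAnnihilator R k ↔ ringPower R (j + 1 + k) = ⊥ := by
  induction k generalizing j with
  | zero => exact le_bot_iff
  | succ k ih =>
    rw [show j + 1 + (k + 1) = j + 1 + 1 + k by omega, ← ih]
    constructor
    · intro h
      refine (AddSubgroup.closure_le _).2 ?_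
      rintro _ ⟨a, ha, b, rfl⟩
      exact h ha b
    · exact fun h a ha b => h (mul_mem_ringPower ha b)

theorem ringPower_succ_eq_bot_iff {k : ℕ} :
    ringPower R (k + 1) = ⊥ ↔ ∀ a, a ∈ leftAnnihilator R k := by
  rw [add_comm, ← zero_add 1, ← ringPower_le_leftAnnihilator_iff]
  exact ⟨fun h a => h (AddSubgroup.mem_top a), fun h a _ => h a⟩

/-- Nakayama: N is a maximal proper right subideal of M. If u r ∉ N, then N + uR = M, so u = n + u w
with n ∈ N; quasi-invertibility of -w then forces u ∈ N. -/
theorem exists_proper_right_ideal [Finite R] (hR : ∀ r : R, ∃ s, r + s + r * s = 0)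
    {M : AddSubgroup R} (hM : ∀ u ∈ M, ∀ r, u * r ∈ M) (hne : M ≠ ⊥) :
    ∃ N < M, ∀ u ∈ M, ∀ r, u * r ∈ N := by
  obtain ⟨N, hN⟩ := ({N : AddSubgroup R | N < M ∧ ∀ u ∈ N, ∀ r, u * r ∈ N}).toFinite.exists_maximal
    ⟨⊥, bot_lt_iff_ne_bot.2 hne, fun u hu r => by
      rw [AddSubgroup.mem_bot] at hu ⊢
      rw [hu, zero_mul]⟩
  obtain ⟨hNM, hNr⟩ := hN.prop
  refine ⟨N, hNM, fun u hu r => ?_⟩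
  by_contra hur
  let U : AddSubgroup R := N ⊔ (AddMonoidHom.mulLeft u).range
  have hU : ∀ v ∈ U, ∀ t, v * t ∈ U := by
    intro v hv t
    obtain ⟨n, hn, _, ⟨w, rfl⟩, rfl⟩ := AddSubgroup.mem_sup.1 hv
    exact AddSubgroup.mem_sup.2 ⟨n * t, hNr n hn t, _, ⟨w * t, rfl⟩, by
      simp [add_mul, mul_assoc]⟩
  have hUM : U ≤ M := sup_le hNM.le (by
    rintro _ ⟨w, rfl⟩
    exact hM u hu w)
  have hUM' : U = M := by
    by_contra hlt
    exact hur (hN.le_of_ge ⟨lt_of_le_of_ne hUM hlt, hU⟩ le_sup_left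
      (AddSubgroup.mem_sup_right ⟨r, rfl⟩))
  obtain ⟨n, hn, _, ⟨w, rfl⟩, hw⟩ := AddSubgroup.mem_sup.1 (hUM' ▸ hu : u ∈ U)
  obtain ⟨s, hs⟩ := hR (-w)
  -- Formally n = u(1 - w) and (1 - w)(1 + s) = 1, whence u = n(1 + s).
  have hn' : n = u + u * -w := by
    rw [eq_sub_of_add_eq hw]
    simp [sub_eq_add_neg]
  have hu' : n + n * s = u := by
    have h : n + n * s = u + u * (-w + s + -w * s) := by
      rw [hn', add_mul, mul_add, mul_add, mul_assoc]
      abel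
    rw [h, hs, mul_zero, add_zero]
  exact hur (hNr u (hu' ▸ add_mem hn (hNr n hn s)) r)

theorem exists_isNilpotentOfClass [Finite R] (hR : ∀ r : R, ∃ s, r + s + r * s = 0) :
    ∃ m, IsNilpotentOfClass R m := by
  classical
  have h : ∃ m, 1 ≤ m ∧ ringPower R m = ⊥ := by
    by_contra! hne
    -- If no power vanished, the powers would form an infinite strictly descending chain in a finite
    -- ring.
    have hanti : StrictAnti fun k => ringPower R (k + 1) := by
      refine strictAnti_nat_of_succ_lt fun k => ?_
      obtain ⟨N, hN, hr⟩ := exists_proper_right_ideal hR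
        (fun u hu r => ringPower_succ_le k (mul_mem_ringPower hu r)) (hne (k + 1) (by omega))
      refine lt_of_le_of_lt ((AddSubgroup.closure_le _).2 ?_) hN
      rintro _ ⟨a, ha, b, rfl⟩
      exact hr a ha b
    exact not_injective_infinite_finite _ hanti.injective
  exact ⟨Nat.find h, (Nat.find_spec h).1, (Nat.find_spec h).2,
    fun k h1 hk he => Nat.find_min h hk ⟨h1, he⟩⟩

end Ring

/-! ### The radical ring of a two-sided brace -/

section TwoSided

variable {B : Type u} [LeftBrace B] (h : IsTwoSided B)

/-- The identity map of a two-sided brace into its radical ring. -/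
def toRadicalRing : B ≃+ RadicalRing h := AddEquiv.refl B

theorem toRadicalRing_mul (a b : B) : toRadicalRing h a * toRadicalRing h b =
    toRadicalRing h (LeftBrace.lam a b) - toRadicalRing h b := rfl

theorem RadicalRing.exists_quasi_inverse (r : RadicalRing h) : ∃ s, r + s + r * s = 0 := by
  obtain ⟨a, rfl⟩ := (toRadicalRing h).surjective r
  refine ⟨toRadicalRing h a⁻¹, ?_⟩
  rw [toRadicalRing_mul, add_assoc, add_sub_cancel, ← map_add, LeftBrace.add_lam, mul_inv_cancel,
    LeftBrace.one_eq_zero, map_zero]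

theorem exists_isNilpotentOfClass_radicalRing [Finite B] :
    ∃ m, IsNilpotentOfClass (RadicalRing h) m :=
  have : Finite (RadicalRing h) := Finite.of_equiv B (toRadicalRing h).toEquiv
  exists_isNilpotentOfClass (RadicalRing.exists_quasi_inverse h)

/-- Right distributivity is what matters here: ᵃz - ᵇz = a * z - b * z = (a - b) * z. -/
theorem retRel_toSolution_iff {k : ℕ} {a b : B} : (LeftBrace.toSolution B).retRel k a b ↔
    toRadicalRing h a - toRadicalRing h b ∈ leftAnnihilator (RadicalRing h) k := by
  induction k generalizing a b with
  | zero =>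
    rw [mem_leftAnnihilator_zero, sub_eq_zero, (toRadicalRing h).injective.eq_iff]
    rfl
  | succ k ih =>
    rw [mem_leftAnnihilator_succ, (toRadicalRing h).surjective.forall]
    refine forall_congr' fun z => ?_
    change (LeftBrace.toSolution B).retRel k (LeftBrace.lam a z) (LeftBrace.lam b z) ↔ _
    rw [ih, sub_mul, toRadicalRing_mul, toRadicalRing_mul, sub_sub_sub_cancel_right]

theorem mpl_toSolution_le_iff {k : ℕ} : (LeftBrace.toSolution B).mpl ≤ k ↔
    ∀ a : RadicalRing h, a ∈ leftAnnihilator (RadicalRing h) k := by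
  rw [Solution.mpl_le_iff, (toRadicalRing h).surjective.forall]
  simp only [retRel_toSolution_iff h]
  refine ⟨fun H a => ?_, fun H a b => ?_⟩
  · simpa using H a 0
  · simpa using H (a - b)

theorem IsNilpotentOfClass.mpl_toSolution {m : ℕ} (hm : IsNilpotentOfClass (RadicalRing h) m) :
    (LeftBrace.toSolution B).mpl = ((m - 1 : ℕ) : ℕ∞) := by
  obtain ⟨h1, h0, hlt⟩ := hm
  obtain ⟨m, rfl⟩ := Nat.exists_eq_add_of_le' h1
  rw [Nat.add_sub_cancel]
  refine le_antisymm ((mpl_toSolution_le_iff h).2 (ringPower_succ_eq_bot_iff.1 h0)) ?_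
  by_contra! hc
  obtain ⟨n, hn⟩ := ENat.ne_top_iff_exists.1 (ne_top_of_lt hc)
  rw [← hn, Nat.cast_lt] at hc
  exact hlt (n + 1) (by omega) (by omega)
    (ringPower_succ_eq_bot_iff.2 ((mpl_toSolution_le_iff h).1 hn.ge))

theorem IsNilpotentOfClass.one_lt [Nontrivial B] {m : ℕ}
    (hm : IsNilpotentOfClass (RadicalRing h) m) : 1 < m := by
  refine lt_of_le_of_ne hm.1 fun he => ?_
  obtain ⟨a, ha⟩ := exists_ne (0 : B)
  have h0 : (⊤ : AddSubgroup (RadicalRing h)) = ⊥ := by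
    have := hm.2.1
    rwa [← he] at this
  refine ha ((toRadicalRing h).injective ?_)
  rw [map_zero, ← AddSubgroup.mem_bot, ← h0]
  trivial

end TwoSided

/-! ### Braces generated by a solution -/

namespace LeftBrace

variable {X K : Type u} [LeftBrace K] {ι : X → K} {ρ : K →* Equiv.Perm X}

theorem mul_ι (hρ : ∀ g x, lam g (ι x) = ι (ρ g x)) (g : K) (x : X) :
    g * ι x = g + ι (ρ g x) := by
  rw [← add_lam, hρ]

/-- By g · ι x = g + ι(gx), multiplying by a generator amounts to adding one; likewise for inverses.
-/
theorem addClosure_eq_top (hρ : ∀ g x, lam g (ι x) = ι (ρ g x))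
    (gen : Subgroup.closure (Set.range ι) = ⊤) : AddSubgroup.closure (Set.range ι) = ⊤ := by
  rw [eq_top_iff]
  intro g _
  have hι : ∀ x, ι x ∈ AddSubgroup.closure (Set.range ι) :=
    fun x => AddSubgroup.subset_closure ⟨x, rfl⟩
  have hg : g ∈ Subgroup.closure (Set.range ι) := gen ▸ Subgroup.mem_top g
  induction hg using Subgroup.closure_induction_right with
  | one => rw [one_eq_zero]; exact zero_mem _
  | mul_right g y _ hy ih =>
    obtain ⟨x, rfl⟩ := hy
    rw [mul_ι hρ]
    exact add_mem (ih trivial) (hι _)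
  | mul_inv_cancel g y _ hy ih =>
    obtain ⟨x, rfl⟩ := hy
    have h := mul_ι hρ (g * (ι x)⁻¹) x
    rw [inv_mul_cancel_right] at h
    rw [eq_sub_of_add_eq h.symm]
    exact sub_mem (ih trivial) (hι _)

/-- Each `lam a` is additive, so it is determined by its values on the additive generators. -/
theorem lam_eq_of_forall (hρ : ∀ g x, lam g (ι x) = ι (ρ g x))
    (gen : Subgroup.closure (Set.range ι) = ⊤) {a b : K}
    (h : ∀ x, lam a (ι x) = lam b (ι x)) (c : K) : lam a c = lam b c := by
  let φ (a : K) : K →+ K := AddMonoidHom.mk' (lam a) (lam_add a)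
  have he : φ a = φ b := AddMonoidHom.eq_of_eqOn_dense (addClosure_eq_top hρ gen) (by
    rintro _ ⟨x, rfl⟩
    exact h x)
  exact DFunLike.congr_fun he c

/-- The action of K on itself is then trivial, so ab = a + b. -/
theorem isTwoSided_of_lam_ι (hρ : ∀ g x, lam g (ι x) = ι (ρ g x))
    (gen : Subgroup.closure (Set.range ι) = ⊤)
    (h : ∀ x y, lam (ι x) (ι y) = ι y) : IsTwoSided K := by
  have hx : ∀ x c, lam (ι x) c = c := fun x c => by
    rw [lam_eq_of_forall (b := 1) hρ gen (fun y => by rw [h, lam_one]) c, lam_one]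
  have hlam : ∀ a c : K, lam a c = c := by
    intro a
    have ha : a ∈ Subgroup.closure (Set.range ι) := gen ▸ Subgroup.mem_top a
    induction ha using Subgroup.closure_induction with
    | mem _ ha => obtain ⟨x, rfl⟩ := ha; exact hx x
    | one => exact lam_one
    | mul a b _ _ iha ihb => intro c; rw [lam_mul, ihb, iha]
    | inv a _ iha =>
      intro c
      rw [← iha (lam a⁻¹ c), lam_lam_inv]
  intro a b c
  simp only [← add_lam, hlam]
  abel

variable {K' : Type u} [LeftBrace K'] {ι' : X → K'} {ρ' : K' →* Equiv.Perm X}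

/-- Additivity of π is the point. It is checked for ι x + b = b · ι(b⁻¹x), a product, and then
propagated over the additive closure. -/
theorem map_lam (hρ : ∀ g x, lam g (ι x) = ι (ρ g x))
    (gen : Subgroup.closure (Set.range ι) = ⊤) (hρ' : ∀ g x, lam g (ι' x) = ι' (ρ' g x))
    {π : K →* K'} (hι : ∀ x, π (ι x) = ι' x) (hπ : ∀ g, ρ' (π g) = ρ g) (a b : K) :
    π (lam a b) = lam (π a) (π b) := by
  have hadd : ∀ a b, π (a + b) = π a + π b := by
    intro a
    have ha : a ∈ AddSubgroup.closure (Set.range ι) :=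
      addClosure_eq_top hρ gen ▸ AddSubgroup.mem_top a
    induction ha using AddSubgroup.closure_induction with
    | mem _ ha =>
      obtain ⟨x, rfl⟩ := ha
      intro b
      have h1 : ι x + b = b * ι (ρ b⁻¹ x) := by
        rw [mul_ι hρ, add_comm, ← Equiv.Perm.mul_apply, ← map_mul, mul_inv_cancel, map_one,
          Equiv.Perm.one_apply]
      have h2 : ρ' (π b) (ρ b⁻¹ x) = x := by
        rw [hπ, ← Equiv.Perm.mul_apply, ← map_mul, mul_inv_cancel, map_one, Equiv.Perm.one_apply]
      rw [h1, map_mul, hι, hι, mul_ι hρ', h2, add_comm]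
    | zero =>
      intro b
      rw [zero_add, ← one_eq_zero, map_one, one_eq_zero, zero_add]
    | add a b _ _ iha ihb => intro c; rw [add_assoc, iha, ihb, iha, add_assoc]
    | neg a _ iha =>
      have h : ∀ b, π (-a + b) = π b - π a := fun b => by
        rw [eq_sub_iff_add_eq', ← iha, add_neg_cancel_left]
      intro b
      have h0 := h 0
      rw [add_zero, ← one_eq_zero, map_one, one_eq_zero, zero_sub] at h0
      rw [h, h0, sub_eq_neg_add]
  have h := congrArg π (add_lam a b)
  rw [hadd, map_mul, ← add_lam] at h
  exact add_left_cancel h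

end LeftBrace

/-! ### The groups `G(X, r)` and `𝒢(X, r)` -/

namespace Solution

variable {X : Type u} (S : Solution X)

theorem lam_toYBGroup (g : S.YBGroup) (x : X) :
    LeftBrace.lam g (S.toYBGroup x) = S.toYBGroup (S.leftAction g x) :=
  S.ybGroupData.lam_ι g x

/-- The canonical map `X → 𝒢(X, r)`. -/
noncomputable def toPermGroupOf (x : X) : S.PermGroup := S.toPermGroup (S.toYBGroup x)

theorem lam_toPermGroupOf (g : S.PermGroup) (x : X) :
    LeftBrace.lam g (S.toPermGroupOf x) = S.toPermGroupOf (S.permGroupData.ρ g x) :=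
  S.permGroupData.lam_ι g x

theorem closure_range_toPermGroupOf : Subgroup.closure (Set.range S.toPermGroupOf) = ⊤ :=
  S.permGroupData.gen

theorem permGroupData_ρ_toPermGroupOf (x : X) : S.permGroupData.ρ (S.toPermGroupOf x) = S.L x :=
  S.permGroupData.ρ_ι x

theorem permGroupData_ρ_injective : Function.Injective S.permGroupData.ρ :=
  Subtype.val_injective

theorem toPermGroupOf_eq_iff {x y : X} : S.toPermGroupOf x = S.toPermGroupOf y ↔ S.L x = S.L y := by
  rw [← S.permGroupData_ρ_injective.eq_iff, permGroupData_ρ_toPermGroupOf,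
    permGroupData_ρ_toPermGroupOf]

theorem lam_toPermGroupOf_toPermGroupOf (x y : X) :
    LeftBrace.lam (S.toPermGroupOf x) (S.toPermGroupOf y) = S.toPermGroupOf (S.L x y) := by
  rw [lam_toPermGroupOf, permGroupData_ρ_toPermGroupOf]

theorem addClosure_range_toPermGroupOf :
    AddSubgroup.closure (Set.range S.toPermGroupOf) = ⊤ :=
  LeftBrace.addClosure_eq_top S.lam_toPermGroupOf S.closure_range_toPermGroupOf

instance [Finite X] : Finite S.PermGroup := Finite.of_injective _ S.permGroupData_ρ_injective

theorem nontrivial_permGroup_of_L_ne_one {x : X} (h : S.L x ≠ 1) : Nontrivial S.PermGroup := by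
  refine ⟨S.toPermGroupOf x, 1, fun he => h ?_⟩
  rw [← permGroupData_ρ_toPermGroupOf, he, map_one]

theorem subsingleton_permGroup [Subsingleton X] : Subsingleton S.PermGroup :=
  S.permGroupData_ρ_injective.subsingleton

/-- The action of the generators of `G(X, r)` by affine permutations of `ℤ^X`. -/
noncomputable def affinePerm (x : X) : Equiv.Perm (X → ℤ) :=
  letI := Classical.decEq X
  (Equiv.arrowCongr (S.L x) (Equiv.refl ℤ)).trans (Equiv.addLeft (Pi.single x 1))

theorem affinePerm_apply [DecidableEq X] (x : X) (f : X → ℤ) (y : X) :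
    S.affinePerm x f y = (Pi.single x 1 : X → ℤ) y + f ((S.L x)⁻¹ y) := by
  obtain rfl : ‹DecidableEq X› = Classical.decEq X := Subsingleton.elim _ _
  rfl

/-- The linear parts agree by `L_mul_L`. The translation parts are e_x + e_(ˣy) on both sides, by
`L_L_R`. -/
theorem affinePerm_rel (x y : X) : S.affinePerm x * S.affinePerm y =
    S.affinePerm (S.L x y) * S.affinePerm (S.R y x) := by
  classical
  have hs : ∀ u v z : X, (Pi.single v 1 : X → ℤ) ((S.L u)⁻¹ z) =
      (Pi.single (S.L u v) 1 : X → ℤ) z := fun u v z => by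
    simp only [Pi.single_apply, Equiv.Perm.inv_eq_iff_eq]
  have hL : ∀ z, (S.L y)⁻¹ ((S.L x)⁻¹ z) = (S.L (S.R y x))⁻¹ ((S.L (S.L x y))⁻¹ z) := fun z => by
    rw [← Equiv.Perm.mul_apply, ← Equiv.Perm.mul_apply, ← mul_inv_rev, ← mul_inv_rev, L_mul_L]
  ext f z
  simp only [Equiv.Perm.mul_apply, affinePerm_apply, hs, hL, L_L_R]
  ring

/-- In the affine action on ℤ^X, the generator x sends 0 to the basis vector e_x. -/
theorem toYBGroup_injective : Function.Injective S.toYBGroup := by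
  classical
  let φ : S.YBGroup →* Equiv.Perm (X → ℤ) :=
    PresentedGroup.toGroup (f := S.affinePerm) (rels := S.relations) (by
      rintro _ ⟨x, y, rfl⟩
      simp only [map_mul, map_inv, FreeGroup.lift_apply_of]
      rw [mul_inv_eq_one]
      exact S.affinePerm_rel x y)
  have hφ : ∀ x, φ (S.toYBGroup x) = S.affinePerm x := fun x => PresentedGroup.toGroup.of _
  intro x y hxy
  have h := DFunLike.congr_fun (congrArg φ hxy) 0
  rw [hφ, hφ] at h
  have h' := congrFun h x
  simp only [affinePerm_apply, Pi.single_apply, Pi.zero_apply, add_zero, if_true] at h'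
  by_contra hne
  simp [hne] at h'

theorem mpl_le_mpl_ybSolution [Nonempty X] {k : ℕ} (h : S.ybSolution.mpl ≤ k) : S.mpl ≤ k := by
  rw [mpl_le_iff] at h ⊢
  intro x y
  refine S.retRel_of_injective (T := S.ybSolution) S.toYBGroup_injective (fun x y => ?_) (h _ _)
  change _ = LeftBrace.lam (S.toYBGroup x) (S.toYBGroup y)
  rw [lam_toYBGroup, leftAction_of]

theorem toPermGroup_lam (g h : S.YBGroup) : S.toPermGroup (LeftBrace.lam g h) =
    LeftBrace.lam (S.toPermGroup g) (S.toPermGroup h) :=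
  LeftBrace.map_lam (ι' := S.toPermGroupOf) S.lam_toYBGroup S.closure_range_toYBGroup
    S.lam_toPermGroupOf (fun _ => rfl) (fun _ => rfl) g h

/-- This identifies 𝒢 with Ret G. Equal actions on X give equal actions on the additive generators
of G; the converse needs the embedding of X in G. -/
theorem toPermGroup_eq_iff (g h : S.YBGroup) :
    S.toPermGroup g = S.toPermGroup h ↔ S.ybSolution.retRel 1 g h := by
  rw [← S.permGroupData_ρ_injective.eq_iff]
  change S.leftAction g = S.leftAction h ↔ ∀ z, LeftBrace.lam g z = LeftBrace.lam h z
  constructor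
  · intro he
    refine LeftBrace.lam_eq_of_forall S.lam_toYBGroup S.closure_range_toYBGroup fun x => ?_
    rw [lam_toYBGroup, lam_toYBGroup, he]
  · intro he
    ext x
    apply S.toYBGroup_injective
    rw [← lam_toYBGroup, ← lam_toYBGroup, he]

theorem mpl_permSolution_le_iff {k : ℕ} :
    S.permSolution.mpl ≤ k ↔ S.ybSolution.mpl ≤ (1 + k : ℕ) :=
  S.ybSolution.mpl_le_add_iff (T := S.permSolution) (p := S.toPermGroup)
    S.leftAction.rangeRestrict_surjective S.toPermGroup_lam S.toPermGroup_eq_iff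

/-! ### Comparing X with the radical ring of 𝒢 -/

section TwoSided

variable (h : IsTwoSided S.PermGroup)

/-- The canonical map from `X` to the radical ring of `𝒢(X, r)`. -/
noncomputable def toRing (x : X) : RadicalRing h := toRadicalRing h (S.toPermGroupOf x)

theorem mul_toRing (g : S.PermGroup) (x : X) : toRadicalRing h g * S.toRing h x =
    S.toRing h (S.permGroupData.ρ g x) - S.toRing h x := by
  rw [toRing, toRadicalRing_mul, lam_toPermGroupOf]
  rfl

theorem toRing_mul_toRing (x y : X) :
    S.toRing h x * S.toRing h y = S.toRing h (S.L x y) - S.toRing h y := by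
  rw [toRing, mul_toRing, permGroupData_ρ_toPermGroupOf]

theorem addClosure_range_toRing : AddSubgroup.closure (Set.range (S.toRing h)) = ⊤ := by
  have h' := congrArg (AddSubgroup.map (toRadicalRing h).toAddMonoidHom)
    S.addClosure_range_toPermGroupOf
  rw [AddMonoidHom.map_closure, ← Set.range_comp] at h'
  exact h'.trans (AddSubgroup.map_top_of_surjective _ (toRadicalRing h).surjective)

theorem mem_leftAnnihilator_succ_of_toRing {k : ℕ} {a : RadicalRing h}
    (ha : ∀ x, a * S.toRing h x ∈ leftAnnihilator (RadicalRing h) k) :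
    a ∈ leftAnnihilator (RadicalRing h) (k + 1) :=
  mem_leftAnnihilator_succ_of_closure (S.addClosure_range_toRing h) (by
    rintro _ ⟨x, rfl⟩
    exact ha x)

theorem mem_leftAnnihilator_of_toRing {k : ℕ}
    (hx : ∀ x, S.toRing h x ∈ leftAnnihilator (RadicalRing h) k) (a : RadicalRing h) :
    a ∈ leftAnnihilator (RadicalRing h) k := by
  have hle : AddSubgroup.closure (Set.range (S.toRing h)) ≤ leftAnnihilator (RadicalRing h) k :=
    (AddSubgroup.closure_le _).2 (by
      rintro _ ⟨x, rfl⟩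
      exact hx x)
  exact hle (S.addClosure_range_toRing h ▸ AddSubgroup.mem_top a)

/-- The index drops by one because X → 𝒢 already identifies points with the same L. -/
theorem toRing_sub_mem_of_retRel {k : ℕ} {x y : X} (hxy : S.retRel (k + 1) x y) :
    S.toRing h x - S.toRing h y ∈ leftAnnihilator (RadicalRing h) k := by
  induction k generalizing x y with
  | zero =>
    rw [mem_leftAnnihilator_zero, sub_eq_zero, toRing, toRing,
      S.toPermGroupOf_eq_iff.2 (S.retRel_one.1 hxy)]
  | succ k ih =>
    refine S.mem_leftAnnihilator_succ_of_toRing h fun z => ?_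
    rw [sub_mul, toRing_mul_toRing, toRing_mul_toRing, sub_sub_sub_cancel_right]
    exact ih (hxy z)

theorem mpl_permSolution_le [Nonempty X] (h : IsTwoSided S.PermGroup) {k : ℕ}
    (hk : S.mpl ≤ k) : S.permSolution.mpl ≤ k := by
  have hrel := S.mpl_le_iff.1 hk
  refine (mpl_toSolution_le_iff h).2 ?_
  cases k with
  | zero =>
    have : Subsingleton X := ⟨hrel⟩
    have := S.subsingleton_permGroup
    intro a
    exact (toRadicalRing h).symm.injective (Subsingleton.elim _ _)
  | succ k =>
    rw [(toRadicalRing h).surjective.forall]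
    intro g
    -- Multiplying g by a generator restores the lost level: g * ι x is a difference of two images
    -- of points.
    refine S.mem_leftAnnihilator_succ_of_toRing h fun x => ?_
    rw [mul_toRing]
    exact S.toRing_sub_mem_of_retRel h (hrel _ _)

theorem mpl_permSolution_le_of_isSquareFree [Nonempty X] (h : IsTwoSided S.PermGroup)
    (hS : S.IsSquareFree) {k : ℕ} (hk : S.mpl ≤ (k + 1 : ℕ)) : S.permSolution.mpl ≤ k := by
  have hL : ∀ x, S.L x x = x := fun x => congrArg Prod.fst (hS x)
  have hrel := S.mpl_le_iff.1 hk
  refine (mpl_toSolution_le_iff h).2 (S.mem_leftAnnihilator_of_toRing h fun x => ?_)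
  cases k with
  | zero =>
    have h1 : S.L x = 1 := by
      ext y
      rw [(S.retRel_one.1 (hrel x y)), hL, Equiv.Perm.one_apply]
    have h2 : S.toPermGroupOf x = 1 := by
      apply S.permGroupData_ρ_injective
      rw [permGroupData_ρ_toPermGroupOf, h1, map_one]
    rw [mem_leftAnnihilator_zero, toRing, h2, LeftBrace.one_eq_zero, map_zero]
  | succ k =>
    refine S.mem_leftAnnihilator_succ_of_toRing h fun z => ?_
    -- Square-freeness gives x * z = (x - z) * z, so the bound on differences applies to x itself.
    have hz : S.toRing h z * S.toRing h z = 0 := by rw [toRing_mul_toRing, hL, sub_self]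
    have hxz := S.toRing_sub_mem_of_retRel h (hrel x z) (S.toRing h z)
    rwa [sub_mul, hz, sub_zero] at hxz

theorem exists_nilpotency_class_mpl [Finite X] [Nonempty X] [Nontrivial S.PermGroup] :
    ∃ m : ℕ, 1 < m ∧ IsNilpotentOfClass (RadicalRing h) m ∧
      S.permSolution.mpl = ((m - 1 : ℕ) : ℕ∞) ∧
      ((m - 1 : ℕ) : ℕ∞) ≤ S.mpl ∧ S.mpl ≤ m ∧ S.ybSolution.mpl = m ∧
      (S.IsSquareFree → S.mpl = m) := by
  obtain ⟨m, hm⟩ := exists_isNilpotentOfClass_radicalRing h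
  have hm1 := hm.one_lt h
  have hperm : S.permSolution.mpl = ((m - 1 : ℕ) : ℕ∞) := hm.mpl_toSolution h
  have hyb (k : ℕ) : S.ybSolution.mpl ≤ (1 + k : ℕ) ↔ m - 1 ≤ k := by
    rw [← mpl_permSolution_le_iff, hperm, Nat.cast_le]
  have hG : S.ybSolution.mpl ≤ m := by
    have := (hyb (m - 1)).2 le_rfl
    rwa [show 1 + (m - 1) = m by omega] at this
  have hX : S.mpl ≤ m := S.mpl_le_mpl_ybSolution hG
  refine ⟨m, hm1, hm, hperm, ?_, hX, le_antisymm hG ?_, fun hS => le_antisymm hX ?_⟩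
  · by_contra! hc
    obtain ⟨n, hn⟩ := ENat.ne_top_iff_exists.1 (ne_top_of_lt hc)
    have h2 := S.mpl_permSolution_le h hn.ge
    rw [hperm, hn] at h2
    exact absurd h2 (not_le.2 hc)
  · by_contra! hc
    obtain ⟨n, hn⟩ := ENat.ne_top_iff_exists.1 (ne_top_of_lt hc)
    rw [← hn, Nat.cast_lt] at hc
    -- As m ≥ 2, the assumption n < m reads n ≤ 1 + (m - 2), and `hyb` yields the absurd m - 1 ≤ m -
    -- 2.
    have h2 := (hyb (m - 2)).1 (hn.ge.trans (Nat.cast_le.2 (by omega)))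
    omega
  · by_contra! hc
    obtain ⟨n, hn⟩ := ENat.ne_top_iff_exists.1 (ne_top_of_lt hc)
    rw [← hn, Nat.cast_lt] at hc
    have h2 : S.permSolution.mpl ≤ (m - 2 : ℕ) :=
      S.mpl_permSolution_le_of_isSquareFree h hS (hn.ge.trans (Nat.cast_le.2 (by omega)))
    rw [hperm, Nat.cast_le] at h2
    omega

end TwoSided

/-! ### Derived permutation groups -/

theorem isTwoSided_permGroup_of_L_L_eq (h : ∀ x y, S.L (S.L x y) = S.L y) :
    IsTwoSided S.PermGroup :=
  LeftBrace.isTwoSided_of_lam_ι S.lam_toPermGroupOf S.closure_range_toPermGroupOf fun x y => by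
    rw [lam_toPermGroupOf_toPermGroupOf, toPermGroupOf_eq_iff, h]

theorem isTwoSided_permGroup_of_mpl_le_one [Nonempty X] (h : S.mpl ≤ 1) :
    IsTwoSided S.PermGroup :=
  S.isTwoSided_permGroup_of_L_L_eq fun _ _ =>
    S.retRel_one.1 ((S.mpl_le_iff (k := 1)).1 (mod_cast h) _ _)

theorem L_eq_one_of_not_nontrivial (h : ¬ Nontrivial S.PermGroup) (x : X) : S.L x = 1 := by
  by_contra hx
  exact h (S.nontrivial_permGroup_of_L_ne_one hx)

theorem mpl_le_one_of_not_nontrivial [Nonempty X] (h : ¬ Nontrivial S.PermGroup) : S.mpl ≤ 1 := by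
  refine mod_cast (S.mpl_le_iff (k := 1)).2 fun x y => S.retRel_one.2 ?_
  rw [S.L_eq_one_of_not_nontrivial h, S.L_eq_one_of_not_nontrivial h]

/-- Triviality of the action on Ret X says that ˣy and y lie in the same class. -/
theorem isTwoSided_permGroup_of_ret (h : ¬ Nontrivial S.ret.PermGroup) :
    IsTwoSided S.PermGroup :=
  S.isTwoSided_permGroup_of_L_L_eq fun x y => by
    have hx := DFunLike.congr_fun (S.ret.L_eq_one_of_not_nontrivial h
      (Quotient.mk S.retSetoid x)) (Quotient.mk S.retSetoid y)
    exact (Quotient.exact hx : S.L (S.L x y) = S.L y)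

theorem exists_isTwoSided_derivedPermGroup [Nonempty X] (h2 : 2 ≤ S.mpl) (ht : S.mpl < ⊤) :
    ∃ j : ℕ, IsTwoSided (S.DerivedPermGroup j) ∧ Nontrivial (S.DerivedPermGroup j) := by
  obtain ⟨n, hn⟩ := ENat.ne_top_iff_exists.1 ht.ne
  rw [← hn] at h2
  obtain ⟨n, rfl⟩ := Nat.exists_eq_add_of_le' (show 2 ≤ n from mod_cast h2)
  by_cases hnt : Nontrivial (S.DerivedPermGroup (n + 1))
  -- Here mpl X = n + 2, so Ret^(n+1) X has level at most 1.
  · refine ⟨n + 1, isTwoSided_permGroup_of_mpl_le_one _ ?_, hnt⟩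
    exact mod_cast (S.mpl_retIter_le_iff (j := n + 1) (k := 1)).2 hn.ge
  · refine ⟨n, isTwoSided_permGroup_of_ret _ hnt, ?_⟩
    -- A trivial 𝒢_n would give mpl X ≤ n + 1.
    by_contra hc
    have h1 : (S.retIter n).sol.mpl ≤ (1 : ℕ) := mod_cast mpl_le_one_of_not_nontrivial _ hc
    rw [mpl_retIter_le_iff, ← hn, Nat.cast_le] at h1
    omega

theorem not_nontrivial_derivedPermGroup [Nonempty X] {j : ℕ} (h : S.mpl ≤ j) :
    ¬ Nontrivial (S.DerivedPermGroup j) := by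
  have h0 : (S.retIter j).sol.mpl ≤ (0 : ℕ) := S.mpl_retIter_le_iff.2 h
  have : Subsingleton (S.retIter j).carrier := ⟨mpl_le_iff _ |>.1 h0⟩
  exact not_nontrivial_iff_subsingleton.2 (subsingleton_permGroup _)

theorem mpl_of_isTwoSided_derivedPermGroup [Finite X] [Nonempty X] {j : ℕ}
    (h : IsTwoSided (S.DerivedPermGroup j)) (hnt : Nontrivial (S.DerivedPermGroup j)) :
    (2 ≤ S.mpl ∧ S.mpl < ⊤) ∨ (S.mpl = 1 ∧ Nontrivial S.PermGroup) := by
  obtain ⟨m, -, -, -, -, hm, -, -⟩ := (S.retIter j).sol.exists_nilpotency_class_mpl h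
  obtain ⟨n, hn⟩ := ENat.ne_top_iff_exists.1
    (ne_top_of_le_ne_top (ENat.natCast_ne_top _) (S.mpl_retIter_le_iff.1 hm))
  -- From level n = mpl X on, the retractions have one point and trivial permutation group.
  have hj : j < n := by
    by_contra! hc
    exact S.not_nontrivial_derivedPermGroup (hn.ge.trans (Nat.cast_le.2 hc)) hnt
  rcases Nat.lt_or_ge n 2 with h2 | h2
  · obtain rfl : n = 1 := by omega
    obtain rfl : j = 0 := by omega
    exact Or.inr ⟨hn.symm, hnt⟩
  · rw [← hn]
    exact Or.inl ⟨mod_cast h2, ENat.natCast_lt_top n⟩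

end Solution

end YBE

theorem mainTheorem12 {X : Type u} [Finite X] [Nonempty X] (S : YBE.Solution X) :
    (∀ h : YBE.IsTwoSided S.PermGroup, Nontrivial S.PermGroup →
      ∃ m : ℕ, 1 < m ∧ YBE.IsNilpotentOfClass (YBE.RadicalRing h) m ∧
        S.permSolution.mpl = ((m - 1 : ℕ) : ℕ∞) ∧
        ((m - 1 : ℕ) : ℕ∞) ≤ S.mpl ∧ S.mpl ≤ m ∧
        S.ybSolution.mpl = m ∧
        (S.IsSquareFree → S.mpl = m)) ∧
    ((2 ≤ S.mpl ∧ S.mpl < ⊤) ∨ (S.mpl = 1 ∧ Nontrivial S.PermGroup) ↔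
      ∃ j : ℕ, YBE.IsTwoSided (S.DerivedPermGroup j) ∧ Nontrivial (S.DerivedPermGroup j)) := by
  refine ⟨fun h _ => S.exists_nilpotency_class_mpl h, ?_, ?_⟩
  · rintro (⟨h2, ht⟩ | ⟨h1, hnt⟩)
    · exact S.exists_isTwoSided_derivedPermGroup h2 ht
    · exact ⟨0, S.isTwoSided_permGroup_of_mpl_le_one h1.le, hnt⟩
  · rintro ⟨j, h, hnt⟩
    exact S.mpl_of_isTwoSided_derivedPermGroup h hnt
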